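/- Let $M$ be a metric space with at least two points and let $0\in M$ be a distinguished point. Let $\operatorname{Lip}_0(M)$ be the real normed space of Lipschitz functions $f:M\to\mathbb{R}$ with $f(0)=0$, with the norm $$\|f\|=\sup\Big\{\frac{|f(q)-f(p)|}{d(p,q)} : p,q\in M,\ p\neq q\Big\}.$$ Let $\operatorname{SNA}(M)\subseteq \operatorname{Lip}_0(M)$ be the set of functions for which this supremum is a maximum, and let $\overline{\operatorname{SNA}(M)}$ be its norm-closure. Let $\mathcal{F}(M)$ be the norm-closed linear span in $\operatorname{Lip}_0(M)^*$ of the evaluations $\delta_x$, $x\in M$, where $\delta_x(f)=f(x)$. For $f\in\operatorname{Lip}_0(M)$ let $T_f\in\mathcal{F}(M)^*$ be the functional $T_f(\mu)=\mu(f)$, and let $\operatorname{NA}(\mathcal{F}(M))$ be the set of those $f\in\operatorname{Lip}_0(M)$ for which there is $\mu\in\mathcal{F}(M)$ with $\|\mu\|=1$ and $|T_f(\mu)|=\|T_f\|$. Call $M$ a length (respectively, metrically convex) space if for all $x\neq y$ in $M$ the distance $d(x,y)$ is the infimum (respectively, the minimum) of the lengths of the rectifiable curves joining $x$ and $y$;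 in particular such curves exist. Say that a subset $S$ of a normed space $Y$ isometrically contains a normed space $X$ if there is a linear isometry $T:X\to Y$ (not necessarily onto) with $T(X)\subseteq S$. Let $\ell_\infty$ and $c_0$ be the spaces of bounded real sequences and of real sequences tending to $0$, with the supremum norm. (a) If $M$ is a complete length space, then $(\operatorname{Lip}_0(M)\setminus\overline{\operatorname{SNA}(M)})\cup\{0\}$ isometrically contains $\ell_\infty$. (b) If $M$ is metrically convex, then $(\operatorname{NA}(\mathcal{F}(M))\setminus\overline{\operatorname{SNA}(M)})\cup\{0\}$ isometrically contains $c_0$. -/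

import Mathlib

open scoped ENNReal ZeroAtInfty

/-! ### Length spaces and metrically convex spaces -/

/-- The length of a curve, i.e. its total variation, in `[0, ∞]`. -/
noncomputable def curveLength {M : Type*} [MetricSpace M] {x y : M} (γ : Path x y) : ℝ≥0∞ :=
  eVariationOn γ Set.univ

/-- The set of lengths of the rectifiable curves (continuous curves of finite length)
joining `x` and `y`. -/
def rectifiableLengths {M : Type*} [MetricSpace M] (x y : M) : Set ℝ≥0∞ :=
  {L | ∃ γ : Path x y, curveLength γ ≠ ∞ ∧ L = curveLength γ}

/-- `M` is a length space: the distance of any two distinct points is the infimum of the lengths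
of the rectifiable curves joining them. If there is no such curve the infimum is `∞`, which
is never a distance. -/
def IsLengthMetricSpace (M : Type*) [MetricSpace M] : Prop :=
  ∀ x y : M, x ≠ y → IsGLB (rectifiableLengths x y) (edist x y)

/-- `M` is metrically convex: the distance of any two distinct points is the minimum of the
lengths of the rectifiable curves joining them. -/
def IsMetricallyConvex (M : Type*) [MetricSpace M] : Prop :=
  ∀ x y : M, x ≠ y → IsLeast (rectifiableLengths x y) (edist x y)

/-! ### The space `Lip₀(M)` -/

/-- The vector space of real-valued Lipschitz functions on `M` vanishing at the distinguished
point `o`. -/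
def lip0Submodule {M : Type*} [MetricSpace M] (o : M) : Submodule ℝ (M → ℝ) where
  carrier := {f | (∃ K, LipschitzWith K f) ∧ f o = 0}
  add_mem' := by
    rintro f g ⟨⟨K, hK⟩, hf⟩ ⟨⟨L, hL⟩, hg⟩
    exact ⟨⟨K + L, hK.add hL⟩, by simp [hf, hg]⟩
  zero_mem' := ⟨⟨0, LipschitzWith.const 0⟩, rfl⟩
  smul_mem' := by
    rintro c f ⟨⟨K, hK⟩, hf⟩
    exact ⟨⟨‖c‖₊ * K, (lipschitzWith_smul c).comp hK⟩, by simp [hf]⟩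

/-- `Lip₀(M)`, as a type of its own, so that it carries only the topology of the Lipschitz norm
(and not the one of pointwise convergence inherited from `M → ℝ`). -/
def Lip0 {M : Type*} [MetricSpace M] (o : M) : Type _ := lip0Submodule o

namespace Lip0

variable {M : Type*} [MetricSpace M] {o : M}

noncomputable instance : AddCommGroup (Lip0 o) := inferInstanceAs (AddCommGroup (lip0Submodule o))

noncomputable instance : Module ℝ (Lip0 o) := inferInstanceAs (Module ℝ (lip0Submodule o))

instance : CoeFun (Lip0 o) (fun _ => M → ℝ) := ⟨fun f => f.1⟩

@[simp] theorem add_apply (f g : Lip0 o) (x : M) : (f + g) x = f x + g x := rfl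

@[simp] theorem smul_apply (c : ℝ) (f : Lip0 o) (x : M) : (c • f) x = c * f x := rfl

@[simp] theorem zero_apply (x : M) : (0 : Lip0 o) x = 0 := rfl

@[simp] theorem apply_base (f : Lip0 o) : f o = 0 := f.2.2

theorem ext {f g : Lip0 o} (h : ∀ x, f x = g x) : f = g := Subtype.ext (funext h)

/-- The slope `S(f, p, q) = (f(q) - f(p)) / d(p, q)`. -/
noncomputable def slope (f : Lip0 o) (p q : M) : ℝ := (f q - f p) / dist p q

/-- The Lipschitz norm: the supremum of `|S(f, p, q)|` over all pairs of distinct points. -/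
noncomputable instance : Norm (Lip0 o) :=
  ⟨fun f => sSup {r | ∃ p q : M, p ≠ q ∧ r = |slope f p q|}⟩

theorem norm_def (f : Lip0 o) : ‖f‖ = sSup {r | ∃ p q : M, p ≠ q ∧ r = |slope f p q|} := rfl

theorem bddAbove_slopes (f : Lip0 o) : BddAbove {r | ∃ p q : M, p ≠ q ∧ r = |slope f p q|} := by
  obtain ⟨K, hK⟩ := f.2.1
  refine ⟨K, ?_⟩
  rintro r ⟨p, q, hpq, rfl⟩
  have h := hK.dist_le_mul q p
  rw [Real.dist_eq, dist_comm] at h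
  rw [slope, abs_div, abs_of_pos (dist_pos.2 hpq)]
  exact (div_le_iff₀ (dist_pos.2 hpq)).2 h

theorem abs_slope_le (f : Lip0 o) {p q : M} (h : p ≠ q) : |slope f p q| ≤ ‖f‖ :=
  le_csSup (bddAbove_slopes f) ⟨p, q, h, rfl⟩

theorem norm_nonneg' (f : Lip0 o) : 0 ≤ ‖f‖ :=
  Real.sSup_nonneg (by rintro r ⟨p, q, -, rfl⟩; exact abs_nonneg _)

theorem norm_le_of {f : Lip0 o} {C : ℝ} (hC : 0 ≤ C)
    (h : ∀ p q : M, p ≠ q → |slope f p q| ≤ C) : ‖f‖ ≤ C :=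
  Real.sSup_le (by rintro r ⟨p, q, hpq, rfl⟩; exact h p q hpq) hC

theorem abs_sub_le (f : Lip0 o) (p q : M) : |f q - f p| ≤ ‖f‖ * dist p q := by
  by_cases h : p = q
  · simp [h]
  · have := abs_slope_le f h
    rwa [slope, abs_div, abs_of_pos (dist_pos.2 h), div_le_iff₀ (dist_pos.2 h)] at this

theorem norm_smul_le' (c : ℝ) (f : Lip0 o) : ‖c • f‖ ≤ ‖c‖ * ‖f‖ := by
  refine norm_le_of (mul_nonneg (norm_nonneg c) (norm_nonneg' f)) fun p q h => ?_
  have : slope (c • f) p q = c * slope f p q := by simp only [slope, smul_apply]; ring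
  rw [this, abs_mul, Real.norm_eq_abs]
  exact mul_le_mul_of_nonneg_left (abs_slope_le f h) (abs_nonneg c)

theorem normCore : NormedSpace.Core ℝ (Lip0 o) where
  norm_nonneg := norm_nonneg'
  norm_smul c f := by
    refine le_antisymm (norm_smul_le' c f) ?_
    by_cases hc : c = 0
    · simpa [hc] using norm_nonneg' ((0 : ℝ) • f)
    · have h := norm_smul_le' c⁻¹ (c • f)
      rw [smul_smul, inv_mul_cancel₀ hc, one_smul, norm_inv] at h
      rwa [← le_inv_mul_iff₀ (norm_pos_iff.2 hc)]
  norm_triangle f g := by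
    refine norm_le_of (add_nonneg (norm_nonneg' f) (norm_nonneg' g)) fun p q h => ?_
    have : slope (f + g) p q = slope f p q + slope g p q := by
      simp only [slope, add_apply]; ring
    rw [this]
    exact (abs_add_le _ _).trans (add_le_add (abs_slope_le f h) (abs_slope_le g h))
  norm_eq_zero_iff f := by
    constructor
    · intro h
      refine ext fun x => ?_
      have := abs_sub_le f o x
      rw [h, zero_mul, apply_base, sub_zero] at this
      exact abs_nonpos_iff.1 this
    · rintro rfl
      exact le_antisymm (norm_le_of le_rfl fun p q _ => by simp [slope]) (norm_nonneg' _)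

noncomputable instance : NormedAddCommGroup (Lip0 o) := NormedAddCommGroup.ofCore normCore

noncomputable instance : NormedSpace ℝ (Lip0 o) := NormedSpace.ofCore normCore

end Lip0

/-- `SNA(M)`: the functions in `Lip₀(M)` that strongly attain their norm, i.e. for which the
supremum defining the Lipschitz norm is a maximum. -/
def SNA {M : Type*} [MetricSpace M] (o : M) : Set (Lip0 o) :=
  {f | ∃ p q : M, p ≠ q ∧ |Lip0.slope f p q| = ‖f‖}

/-! ### The Lipschitz-free space and norm attainment as a functional -/

/-- The evaluation functional `δ_x ∈ Lip₀(M)*`. -/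
noncomputable def evalDelta {M : Type*} [MetricSpace M] (o x : M) : Lip0 o →L[ℝ] ℝ :=
  LinearMap.mkContinuous
    { toFun := fun f => f x
      map_add' := fun _ _ => rfl
      map_smul' := fun _ _ => rfl } (dist o x) (by
        intro f
        have h := Lip0.abs_sub_le f o x
        rw [Lip0.apply_base, sub_zero, mul_comm] at h
        exact h)

/-- The norm-closed linear span of the evaluation functionals in `Lip₀(M)*`. -/
noncomputable def freeSubmodule {M : Type*} [MetricSpace M] (o : M) :
    Submodule ℝ (Lip0 o →L[ℝ] ℝ) :=
  (Submodule.span ℝ (Set.range (evalDelta o))).topologicalClosure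

/-- The Lipschitz-free space `F(M)`: the norm-closed linear span of the evaluation functionals
in `Lip₀(M)*`, with the norm of `Lip₀(M)*`. -/
def LipschitzFree {M : Type*} [MetricSpace M] (o : M) : Type _ := freeSubmodule o

namespace LipschitzFree

variable {M : Type*} [MetricSpace M] {o : M}

noncomputable instance : NormedAddCommGroup (LipschitzFree o) :=
  inferInstanceAs (NormedAddCommGroup (freeSubmodule o))

noncomputable instance : NormedSpace ℝ (LipschitzFree o) :=
  inferInstanceAs (NormedSpace ℝ (freeSubmodule o))

/-- The inclusion of `F(M)` in `Lip₀(M)*`. -/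
noncomputable def incl (o : M) : LipschitzFree o →ₗᵢ[ℝ] (Lip0 o →L[ℝ] ℝ) where
  toFun μ := μ.1
  map_add' _ _ := rfl
  map_smul' _ _ := rfl
  norm_map' _ := rfl

/-- The element `δ_x` of `F(M)`. -/
noncomputable def delta (o x : M) : LipschitzFree o :=
  ⟨evalDelta o x, Submodule.le_topologicalClosure _ (Submodule.subset_span ⟨x, rfl⟩)⟩

/-- The functional `T_f ∈ F(M)*` corresponding to `f ∈ Lip₀(M)`, namely `T_f μ = μ f`. -/
noncomputable def functional (f : Lip0 o) : LipschitzFree o →L[ℝ] ℝ :=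
  (ContinuousLinearMap.apply ℝ ℝ f).comp (incl o).toContinuousLinearMap

theorem functional_apply (f : Lip0 o) (μ : LipschitzFree o) : functional f μ = incl o μ f := rfl

/-- `T_f` is the linearization of `f`: `T_f (δ_x) = f x`. -/
theorem functional_delta (f : Lip0 o) (x : M) : functional f (delta o x) = f x := rfl

end LipschitzFree

/-- `NA(X)`: the norm-attaining functionals on a real normed space `X`. -/
def NA (X : Type*) [NormedAddCommGroup X] [NormedSpace ℝ X] : Set (X →L[ℝ] ℝ) :=
  {T | ∃ x : X, ‖x‖ = 1 ∧ |T x| = ‖T‖}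

/-- `NA(F(M))` as a subset of `Lip₀(M)`, under the identification of `f` with `T_f`. -/
def NAFree {M : Type*} [MetricSpace M] (o : M) : Set (Lip0 o) :=
  {f | LipschitzFree.functional f ∈ NA (LipschitzFree o)}

/-! ### Isometric copies -/

/-- The set `S ⊆ Y` isometrically contains the normed space `X`: some linear isometry from `X`
into `Y` has its range in `S`. -/
def IsometricallyContains {Y : Type*} [NormedAddCommGroup Y] [NormedSpace ℝ Y] (S : Set Y)
    (X : Type*) [NormedAddCommGroup X] [NormedSpace ℝ X] : Prop :=
  ∃ T : X →ₗᵢ[ℝ] Y, Set.range T ⊆ S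

/-!
Fix a point `x ≠ o`, let `c = dist o x`, and let `K ⊆ [0, c]` be a closed set with empty interior,
split into countably many pieces `K_n` of positive measure (`CantorPartition`). For a bounded
sequence `a` let `g_a` be the primitive, vanishing at `0`, of the function equal to `a n` on `K_n`
and to `0` off `K`. Both copies are given by the same map `a ↦ g_a ∘ dist o`.

* The map is isometric. Clearly the norm is at most `sup |a n|`. Conversely, an almost geodesic
  from `o` to `x` shows that the norm is at least the Lipschitz constant of `g_a` on `[0, c]`, and
  `g_a` has derivative `a n` at almost every point of `K_n`
  (`CantorPartition.abs_le_norm_lip0`).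
* A nonzero `h = g_a ∘ dist o` is not in the closure of `SNA(M)`, because `g_a` is constant
  somewhere in every interval. A function `f` that attains its norm at `p`, `q` must have slope
  almost `‖f‖` all along an almost geodesic from `p` to `q`. If `f` is close to `h`, then
  `dist o p ≠ dist o q`, so the curve crosses a region where `h` is flat, and there the slopes of
  `f` are too small (`notMem_closure_SNA`).
* If `M` is metrically convex, let `σ` be a geodesic from `o` to `x`. The functional
  `f ↦ |K_n|⁻¹ ∫_{K_n} (f ∘ σ)'` has norm at most one. It lies in `F(M)`, since the integrals over
  intervals are differences of evaluations and the other sets are reached by a Dynkin argument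
  (`curveFunctional_mem_freeSubmodule`). Its value at `g_a ∘ dist o` is `a n`, so the norm is
  attained as soon as `|a n|` is maximal, which happens for some `n` when `a` tends to `0`.
-/

open MeasureTheory

/-! ### Almost geodesic curves -/

theorem Path.edist_add_edist_add_edist_le_curveLength {M : Type*} [MetricSpace M] {x y : M}
    (γ : Path x y) {s t : unitInterval} (hst : s ≤ t) :
    edist x (γ s) + edist (γ s) (γ t) + edist (γ t) y ≤ curveLength γ := by
  have h₁ : edist x (γ s) ≤ eVariationOn γ (Set.univ ∩ Set.Icc 0 s) := by
    simpa using eVariationOn.edist_le γ (s := Set.univ ∩ Set.Icc 0 s) (x := 0) (y := s)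
      (by simp) (by simp)
  have h₂ : edist (γ s) (γ t) ≤ eVariationOn γ (Set.univ ∩ Set.Icc s t) :=
    eVariationOn.edist_le γ (by simp [hst]) (by simp [hst])
  have h₃ : edist (γ t) y ≤ eVariationOn γ (Set.univ ∩ Set.Icc t 1) := by
    simpa using eVariationOn.edist_le γ (s := Set.univ ∩ Set.Icc t 1) (x := t) (y := 1)
      (by simp [unitInterval.le_one']) (by simp [unitInterval.le_one'])
  calc _ ≤ _ := add_le_add (add_le_add h₁ h₂) h₃
    _ = eVariationOn γ (Set.univ ∩ Set.Icc 0 1) := by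
      rw [eVariationOn.Icc_add_Icc _ unitInterval.nonneg' hst (Set.mem_univ s),
        eVariationOn.Icc_add_Icc _ unitInterval.nonneg' unitInterval.le_one' (Set.mem_univ t)]
    _ ≤ curveLength γ := eVariationOn.mono _ (Set.subset_univ _)

/-- The real-valued form of `Path.edist_add_edist_add_edist_le_curveLength`, for a given bound on
the length of the curve. -/
theorem Path.dist_add_dist_add_dist_le {M : Type*} [MetricSpace M] {x y : M} (γ : Path x y)
    {L : ℝ} (hL : 0 ≤ L) (hγ : curveLength γ ≤ ENNReal.ofReal L) {s t : unitInterval}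
    (hst : s ≤ t) : dist x (γ s) + dist (γ s) (γ t) + dist (γ t) y ≤ L := by
  have h := (γ.edist_add_edist_add_edist_le_curveLength hst).trans hγ
  rwa [edist_dist, edist_dist, edist_dist, ← ENNReal.ofReal_add dist_nonneg dist_nonneg,
    ← ENNReal.ofReal_add (by positivity) dist_nonneg, ENNReal.ofReal_le_ofReal_iff hL] at h

theorem IsLengthMetricSpace.exists_path {M : Type*} [MetricSpace M] (hM : IsLengthMetricSpace M)
    (x y : M) {δ : ℝ} (hδ : 0 < δ) : ∃ γ : Path x y, ∀ s t, s ≤ t →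
      dist x (γ s) + dist (γ s) (γ t) + dist (γ t) y ≤ dist x y + δ := by
  rcases eq_or_ne x y with rfl | hxy
  · exact ⟨Path.refl x, fun s t _ => by simpa using hδ.le⟩
  have hlt : edist x y < ENNReal.ofReal (dist x y + δ) := by
    rw [edist_dist, ENNReal.ofReal_lt_ofReal_iff (by positivity)]
    linarith
  obtain ⟨_, ⟨γ, -, rfl⟩, hγ⟩ := (isGLB_lt_iff (hM x y hxy)).1 hlt
  exact ⟨γ, fun s t hst => γ.dist_add_dist_add_dist_le (by positivity) hγ.le hst⟩

theorem IsMetricallyConvex.exists_path {M : Type*} [MetricSpace M] (hM : IsMetricallyConvex M)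
    (x y : M) : ∃ γ : Path x y, ∀ s t, s ≤ t →
      dist x (γ s) + dist (γ s) (γ t) + dist (γ t) y ≤ dist x y := by
  rcases eq_or_ne x y with rfl | hxy
  · exact ⟨Path.refl x, fun s t _ => by simp⟩
  obtain ⟨γ, -, hγ⟩ := (hM x y hxy).1
  exact ⟨γ, fun s t hst =>
    γ.dist_add_dist_add_dist_le dist_nonneg (by rw [← hγ, edist_dist]) hst⟩

theorem IsMetricallyConvex.isLengthMetricSpace {M : Type*} [MetricSpace M]
    (hM : IsMetricallyConvex M) : IsLengthMetricSpace M :=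
  fun x y hxy => (hM x y hxy).isGLB

theorem Path.exists_le_of_continuous {M : Type*} [TopologicalSpace M] {x y : M} (γ : Path x y)
    {ρ : M → ℝ} (hρ : Continuous ρ) {a b : ℝ} (ha : ρ x ≤ a) (hab : a ≤ b) (hb : b ≤ ρ y) :
    ∃ s t, s ≤ t ∧ ρ (γ s) = a ∧ ρ (γ t) = b := by
  have hc : Continuous fun t => ρ (γ t) := hρ.comp γ.continuous
  obtain ⟨t, -, ht⟩ := intermediate_value_Icc (a := (0 : unitInterval)) (b := 1)
    unitInterval.nonneg' hc.continuousOn (show b ∈ Set.Icc _ _ by simp [ha.trans hab, hb])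
  obtain ⟨s, hs, hs'⟩ := intermediate_value_Icc (a := (0 : unitInterval)) (b := t)
    unitInterval.nonneg' hc.continuousOn
    (show a ∈ Set.Icc _ _ from ⟨by simpa using ha, by simpa [ht] using hab⟩)
  exact ⟨s, t, hs.2, hs', ht⟩

/-- In a length space, a real function takes any two values between `ρ x` and `ρ y`, in the right
order, at points lying almost on a geodesic from `x` to `y`. -/
theorem IsLengthMetricSpace.exists_almost_between {M : Type*} [MetricSpace M]
    (hM : IsLengthMetricSpace M) {x y : M} {ρ : M → ℝ} (hρ : Continuous ρ) {a b : ℝ}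
    (ha : ρ x ≤ a) (hab : a ≤ b) (hb : b ≤ ρ y) {δ : ℝ} (hδ : 0 < δ) :
    ∃ u v, ρ u = a ∧ ρ v = b ∧ dist x u + dist u v + dist v y ≤ dist x y + δ := by
  obtain ⟨γ, hγ⟩ := hM.exists_path x y hδ
  obtain ⟨s, t, hst, hs, ht⟩ := γ.exists_le_of_continuous hρ ha hab hb
  exact ⟨_, _, hs, ht, hγ s t hst⟩

/-- A geodesic from `o` to `x`, parametrized by the distance to `o` and extended by constants
to the whole line. -/
theorem IsMetricallyConvex.exists_geodesic {M : Type*} [MetricSpace M]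
    (hM : IsMetricallyConvex M) (o x : M) :
    ∃ σ : ℝ → M, LipschitzWith 1 σ ∧ ∀ t ∈ Set.Icc 0 (dist o x), dist o (σ t) = t := by
  obtain ⟨γ, hγ⟩ := hM.exists_path o x
  have hc : Continuous fun y => dist o y := continuous_const.dist continuous_id
  have hex : ∀ t : Set.Icc 0 (dist o x), ∃ s, dist o (γ s) = t := by
    rintro ⟨t, ht⟩
    obtain ⟨s, -, -, hs, -⟩ := γ.exists_le_of_continuous hc (a := t) (by simpa using ht.1) le_rfl
      ht.2
    exact ⟨s, hs⟩
  choose τ hτ using hex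
  have key : ∀ t t', τ t ≤ τ t' → dist (γ (τ t)) (γ (τ t')) ≤ t' - t := by
    intro t t' h
    have h₁ := hγ _ _ h
    have h₂ := dist_triangle o (γ (τ t')) x
    rw [hτ] at h₁ h₂
    linarith
  have hL : LipschitzWith 1 fun t => γ (τ t) := by
    refine LipschitzWith.of_dist_le_mul fun t t' => ?_
    rw [NNReal.coe_one, one_mul, Subtype.dist_eq, Real.dist_eq]
    rcases le_total (τ t) (τ t') with h | h
    · exact (key _ _ h).trans (by rw [abs_sub_comm]; exact le_abs_self _)
    · rw [dist_comm]
      exact (key _ _ h).trans (le_abs_self _)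
  refine ⟨fun t => γ (τ (Set.projIcc 0 (dist o x) dist_nonneg t)), ?_, fun t ht => ?_⟩
  · have h := hL.comp (LipschitzWith.projIcc (dist_nonneg (x := o) (y := x)))
    rw [one_mul] at h
    exact h
  · rw [hτ, Set.projIcc_of_mem _ ht]

/-! ### Functions far from the strongly norm-attaining ones -/

/-- A nonzero function `g ∘ ρ`, with `g` constant somewhere in every interval, is not a limit of
strongly norm-attaining functions. Indeed, let `f` be close to `g ∘ ρ` and attain its norm at `p`,
`q`. Then `f` has slope almost `‖f‖` along any almost geodesic from `p` to `q`; but such a curve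
has to cross an interval of values of `ρ` on which `g` is constant, where `f` has small slope. -/
theorem notMem_closure_SNA {M : Type*} [MetricSpace M] {o : M} (hM : IsLengthMetricSpace M)
    {ρ : M → ℝ} (hρ : LipschitzWith 1 ρ) {g : ℝ → ℝ}
    (hflat : ∀ x y, x < y → ∃ a b, x ≤ a ∧ a < b ∧ b ≤ y ∧ g a = g b)
    {h : Lip0 o} (hg : ∀ x, h x = g (ρ x)) (h₀ : h ≠ 0) : h ∉ closure (SNA o) := by
  intro hcl
  have hpos : 0 < ‖h‖ := norm_pos_iff.2 h₀
  obtain ⟨f, ⟨p, q, hpq, hatt⟩, hfh⟩ := Metric.mem_closure_iff.1 hcl (‖h‖ / 4) (by positivity)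
  rw [dist_comm, dist_eq_norm] at hfh
  have hf : ‖h‖ / 2 ≤ ‖f‖ := by
    have := norm_sub_norm_le h f
    rw [norm_sub_rev] at this
    linarith
  have hatt' : |f q - f p| = ‖f‖ * dist p q := by
    rwa [Lip0.slope, abs_div, abs_of_pos (dist_pos.2 hpq), div_eq_iff (dist_pos.2 hpq).ne'] at hatt
  have hclose : ∀ u v, g (ρ u) = g (ρ v) → |f v - f u| ≤ ‖h‖ / 4 * dist u v := by
    intro u v huv
    have h₁ := Lip0.abs_sub_le (f - h) u v
    have h₂ : (f - h) v - (f - h) u = f v - f u := by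
      change f v - h v - (f u - h u) = _
      rw [hg, hg, huv]
      ring
    rw [h₂] at h₁
    exact h₁.trans (mul_le_mul_of_nonneg_right hfh.le dist_nonneg)
  clear hatt hcl
  wlog hlt : ρ p < ρ q generalizing p q
  · rcases (not_lt.1 hlt).lt_or_eq with hlt' | heq
    · exact this q p hpq.symm (by rw [abs_sub_comm, hatt', dist_comm]) hlt'
    · have h₁ := hclose p q (by rw [heq])
      rw [hatt'] at h₁
      nlinarith [dist_pos.2 hpq]
  obtain ⟨a, b, hpa, hab, hbq, hgab⟩ := hflat _ _ hlt
  -- The defect `δ` of the almost geodesic is chosen to make the loss on the flat part exceed it.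
  obtain ⟨u, v, hu, hv, huv⟩ := hM.exists_almost_between hρ.continuous hpa hab.le hbq
    (δ := (‖f‖ - ‖h‖ / 4) * (b - a) / (2 * ‖f‖))
    (div_pos (mul_pos (by linarith) (sub_pos.2 hab)) (by linarith))
  have hd : b - a ≤ dist u v := by
    have := hρ.dist_le_mul u v
    rw [hu, hv, NNReal.coe_one, one_mul, Real.dist_eq, abs_sub_comm] at this
    exact (le_abs_self _).trans this
  have h₁ := Lip0.abs_sub_le f p u
  have h₂ := hclose u v (by rw [hu, hv, hgab])
  have h₃ := Lip0.abs_sub_le f v q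
  have h₄ : |f q - f p| ≤ |f u - f p| + |f v - f u| + |f q - f v| := by
    have e : f q - f p = (f u - f p) + (f v - f u) + (f q - f v) := by ring
    rw [e]
    exact abs_add_three _ _ _
  have hf0 : 0 < ‖f‖ := by linarith
  have h₅ : ‖f‖ * (dist p u + dist u v + dist v q)
      ≤ ‖f‖ * dist p q + (‖f‖ - ‖h‖ / 4) * (b - a) / 2 := by
    refine (mul_le_mul_of_nonneg_left huv hf0.le).trans_eq ?_
    field_simp
  have h₆ : (‖f‖ - ‖h‖ / 4) * (b - a) ≤ (‖f‖ - ‖h‖ / 4) * dist u v :=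
    mul_le_mul_of_nonneg_left hd (by linarith)
  have h₇ : 0 < (‖f‖ - ‖h‖ / 4) * (b - a) := mul_pos (by linarith) (sub_pos.2 hab)
  nlinarith

/-! ### Fat Cantor sets split into pieces of positive measure -/

/-- A closed subset of `[0, c]` with empty interior, split by a measurable `index` function
into countably many pieces of positive measure. -/
structure CantorPartition (c : ℝ) where
  /-- The nowhere dense closed set. -/
  carrier : Set ℝ
  /-- The function whose level sets are the pieces. -/
  index : ℝ → ℕ
  subset_Icc : carrier ⊆ Set.Icc 0 c
  isClosed : IsClosed carrier
  interior_eq_empty : interior carrier = ∅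
  measurable_index : Measurable index
  volume_pos (n : ℕ) : 0 < volume (carrier ∩ index ⁻¹' {n})

theorem exists_isClosed_interior_eq_empty_volume_pos {c : ℝ} (hc : 0 < c) :
    ∃ K ⊆ Set.Icc 0 c, IsClosed K ∧ interior K = ∅ ∧ 0 < volume K := by
  obtain ⟨U, hQU, hU, hUc⟩ := (Set.range ((↑) : ℚ → ℝ)).exists_isOpen_lt_of_lt (μ := volume)
    (ENNReal.ofReal c) (by rw [(Set.countable_range _).measure_zero]; simpa using hc)
  refine ⟨Set.Icc 0 c \ U, Set.sdiff_subset, isClosed_Icc.sdiff hU, ?_, ?_⟩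
  · refine Set.not_nonempty_iff_eq_empty.1 fun hne => ?_
    obtain ⟨r, hr⟩ := Rat.denseRange_cast.exists_mem_open isOpen_interior hne
    exact (interior_subset hr).2 (hQU ⟨r, rfl⟩)
  · refine lt_of_lt_of_le ?_ le_measure_sdiff
    rw [Real.volume_Icc, sub_zero]
    exact tsub_pos_of_lt hUc

/-- The pieces are cut out by the continuous function `G t = |K ∩ [0, t]|`: the `n`-th one is
where `n + 1 ≤ G c / G t < n + 2`. The zeros of `G`, where the quotient is `0` by convention, are
put in the piece with index `0`. -/
theorem CantorPartition.nonempty {c : ℝ} (hc : 0 < c) : Nonempty (CantorPartition c) := by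
  obtain ⟨K, hKc, hK, hKi, hKv⟩ := exists_isClosed_interior_eq_empty_volume_pos hc
  have hint : ∀ a b, IntervalIntegrable (K.indicator (fun _ => (1 : ℝ))) volume a b :=
    fun a b => ⟨(integrable_const _).indicator hK.measurableSet,
      (integrable_const _).indicator hK.measurableSet⟩
  let G : ℝ → ℝ := fun t => ∫ s in (0)..t, K.indicator (fun _ => (1 : ℝ)) s
  have hG : Continuous G := intervalIntegral.continuous_primitive hint 0
  have hGsub : ∀ s t, s ≤ t → G t - G s = volume.real (K ∩ Set.Ioc s t) := by
    intro s t hst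
    rw [intervalIntegral.integral_interval_sub_left (hint _ _) (hint _ _),
      intervalIntegral.integral_of_le hst, integral_indicator_const _ hK.measurableSet,
      measureReal_restrict_apply hK.measurableSet, smul_eq_mul, mul_one]
  have hmono : Monotone G := fun s t hst => by
    have := hGsub s t hst
    linarith [measureReal_nonneg (μ := volume) (s := K ∩ Set.Ioc s t)]
  have hG0 : G 0 = 0 := intervalIntegral.integral_same
  have hm : 0 < G c := by
    have h₁ := hGsub 0 c hc.le
    have h₂ : volume (K ∩ Set.Ioc 0 c) = volume K := by
      rw [measure_congr ((ae_eq_refl K).inter Ioc_ae_eq_Icc), Set.inter_eq_left.2 hKc]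
    rw [hG0, sub_zero, measureReal_def, h₂] at h₁
    rw [h₁]
    exact ENNReal.toReal_pos hKv.ne' ((measure_mono hKc).trans_lt measure_Icc_lt_top).ne
  refine ⟨⟨K, fun t => ⌊G c / G t⌋₊ - 1, hKc, hK, hKi, ?_, fun n => ?_⟩⟩
  · exact (measurable_from_top (f := fun k : ℕ => k - 1)).comp
      (Nat.measurable_floor.comp (measurable_const.div hG.measurable))
  have hIVT : ∀ r : ℝ, 1 ≤ r → ∃ x, G x = G c / r := by
    intro r hr
    obtain ⟨x, -, hx⟩ := intermediate_value_Icc hc.le hG.continuousOn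
      (show G c / r ∈ Set.Icc (G 0) (G c) from
        ⟨by rw [hG0]; positivity, div_le_self hm.le hr⟩)
    exact ⟨x, hx⟩
  -- The values of `G c / G` on `(x, y]` lie well inside `[n + 1, n + 2)`.
  have hn : (0 : ℝ) ≤ n := n.cast_nonneg
  obtain ⟨x, hx⟩ := hIVT (n + 5 / 3) (by linarith)
  obtain ⟨y, hy⟩ := hIVT (n + 4 / 3) (by linarith)
  have hGxy : G x < G y := by
    rw [hx, hy]
    exact div_lt_div_of_pos_left hm (by linarith) (by linarith)
  have hxy : x < y := hmono.reflect_lt hGxy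
  have hsub : K ∩ Set.Ioc x y ⊆ K ∩ (fun t => ⌊G c / G t⌋₊ - 1) ⁻¹' {n} := by
    rintro t ⟨htK, htx, hty⟩
    refine ⟨htK, ?_⟩
    have h₁ : G c / (n + 5 / 3) ≤ G t := hx ▸ hmono htx.le
    have h₂ : G t ≤ G c / (n + 4 / 3) := hy ▸ hmono hty
    have ht : 0 < G t := lt_of_lt_of_le (by positivity) h₁
    rw [div_le_iff₀ (by positivity)] at h₁
    rw [le_div_iff₀ (by positivity)] at h₂
    have h₃ : ⌊G c / G t⌋₊ = n + 1 := by
      rw [Nat.floor_eq_iff (by positivity)]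
      push_cast
      constructor
      · rw [le_div_iff₀ ht]
        nlinarith
      · rw [div_lt_iff₀ ht]
        nlinarith
    simp [h₃]
  refine lt_of_lt_of_le (pos_iff_ne_zero.2 fun h => ?_) (measure_mono hsub)
  have := hGsub x y hxy.le
  rw [measureReal_def, h, ENNReal.toReal_zero] at this
  linarith

namespace CantorPartition

variable {c : ℝ} (P : CantorPartition c)

/-- The function taking the value `a n` on the `n`-th piece, and `0` off the Cantor set. -/
noncomputable def density (a : ℕ → ℝ) : ℝ → ℝ :=
  P.carrier.indicator fun t => a (P.index t)

/-- The primitive of `P.density a` vanishing at `0`. -/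
noncomputable def primitive (a : ℕ → ℝ) (x : ℝ) : ℝ :=
  ∫ t in (0)..x, P.density a t

variable {P}

theorem density_of_mem {a : ℕ → ℝ} {n : ℕ} {t : ℝ} (ht : t ∈ P.carrier ∩ P.index ⁻¹' {n}) :
    P.density a t = a n := by
  rw [density, Set.indicator_of_mem ht.1, ht.2]

variable (P)

theorem measurableSet_piece (n : ℕ) : MeasurableSet (P.carrier ∩ P.index ⁻¹' {n}) :=
  P.isClosed.measurableSet.inter (P.measurable_index (measurableSet_singleton n))

theorem measurable_density (a : ℕ → ℝ) : Measurable (P.density a) :=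
  ((measurable_from_top (f := a)).comp P.measurable_index).indicator P.isClosed.measurableSet

theorem abs_density_le {a : ℕ → ℝ} {C : ℝ} (hC : ∀ n, |a n| ≤ C) (t : ℝ) :
    |P.density a t| ≤ C := by
  by_cases ht : t ∈ P.carrier
  · rw [density, Set.indicator_of_mem ht]
    exact hC _
  · rw [density, Set.indicator_of_notMem ht, abs_zero]
    exact (abs_nonneg _).trans (hC 0)

theorem locallyIntegrable_density {a : ℕ → ℝ} {C : ℝ} (hC : ∀ n, |a n| ≤ C) :
    LocallyIntegrable (P.density a) :=
  (locallyIntegrable_const C).mono (P.measurable_density a).aestronglyMeasurable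
    (ae_of_all _ fun t => (P.abs_density_le hC t).trans (le_abs_self C))

theorem intervalIntegrable_density {a : ℕ → ℝ} {C : ℝ} (hC : ∀ n, |a n| ≤ C) (x y : ℝ) :
    IntervalIntegrable (P.density a) volume x y :=
  intervalIntegrable_iff.2 (((P.locallyIntegrable_density hC).integrableOn_isCompact
    isCompact_uIcc).mono_set Set.uIoc_subset_uIcc)

theorem primitive_sub {a : ℕ → ℝ} {C : ℝ} (hC : ∀ n, |a n| ≤ C) (x y : ℝ) :
    P.primitive a y - P.primitive a x = ∫ t in x..y, P.density a t :=
  intervalIntegral.integral_interval_sub_left (P.intervalIntegrable_density hC _ _)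
    (P.intervalIntegrable_density hC _ _)

theorem abs_primitive_sub_le {a : ℕ → ℝ} {C : ℝ} (hC : ∀ n, |a n| ≤ C) (x y : ℝ) :
    |P.primitive a y - P.primitive a x| ≤ C * |y - x| := by
  rw [P.primitive_sub hC]
  exact intervalIntegral.norm_integral_le_of_norm_le_const (f := P.density a)
    fun t _ => P.abs_density_le hC t

theorem primitive_add {a b : ℕ → ℝ} {C D : ℝ} (hC : ∀ n, |a n| ≤ C) (hD : ∀ n, |b n| ≤ D)
    (x : ℝ) : P.primitive (a + b) x = P.primitive a x + P.primitive b x := by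
  rw [primitive, primitive, primitive, ← intervalIntegral.integral_add
    (P.intervalIntegrable_density hC _ _) (P.intervalIntegrable_density hD _ _)]
  exact intervalIntegral.integral_congr fun t _ =>
    congrFun (Set.indicator_add P.carrier (fun t => a (P.index t)) fun t => b (P.index t)) t

theorem primitive_smul (r : ℝ) (a : ℕ → ℝ) (x : ℝ) :
    P.primitive (r • a) x = r * P.primitive a x := by
  rw [primitive, primitive, ← intervalIntegral.integral_const_mul]
  exact intervalIntegral.integral_congr fun t _ =>
    congrFun (Set.indicator_const_smul P.carrier r fun t => a (P.index t)) t

theorem ae_hasDerivAt_primitive {a : ℕ → ℝ} {C : ℝ} (hC : ∀ n, |a n| ≤ C) :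
    ∀ᵐ t, HasDerivAt (P.primitive a) (P.density a t) t :=
  (LocallyIntegrable.ae_hasDerivAt_integral (P.locallyIntegrable_density hC)).mono fun _ ht => ht 0

theorem exists_primitive_eq (a : ℕ → ℝ) {C : ℝ} (hC : ∀ n, |a n| ≤ C) {x y : ℝ} (hxy : x < y) :
    ∃ u v, x ≤ u ∧ u < v ∧ v ≤ y ∧ P.primitive a u = P.primitive a v := by
  have hne : (Set.Ioo x y \ P.carrier).Nonempty := by
    rw [Set.sdiff_nonempty]
    intro hsub
    have := interior_maximal hsub isOpen_Ioo
    rw [P.interior_eq_empty, Set.subset_empty_iff, Set.Ioo_eq_empty_iff] at this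
    exact this hxy
  obtain ⟨z, hz⟩ := hne
  obtain ⟨u, v, huv, hsub⟩ := mem_nhds_iff_exists_Ioo_subset.1
    ((isOpen_Ioo.sdiff P.isClosed).mem_nhds hz)
  have huv' : u < v := huv.1.trans huv.2
  have hIcc : Set.Icc u v ⊆ Set.Icc x y := by
    rw [← closure_Ioo huv'.ne, ← closure_Ioo hxy.ne]
    exact closure_mono (hsub.trans Set.sdiff_subset)
  refine ⟨u, v, (hIcc (Set.left_mem_Icc.2 huv'.le)).1, huv', (hIcc (Set.right_mem_Icc.2 huv'.le)).2,
    ?_⟩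
  rw [eq_comm, ← sub_eq_zero, P.primitive_sub hC, intervalIntegral.integral_of_le huv'.le,
    integral_Ioc_eq_integral_Ioo]
  exact setIntegral_eq_zero_of_forall_eq_zero fun t ht => Set.indicator_of_notMem (hsub ht).2 _

/-! ### The functions `P.primitive a ∘ dist o` -/

variable {M : Type*} [MetricSpace M] {o : M}

/-- The function `P.primitive a ∘ dist o` of `Lip₀(M)`, for a bounded sequence `a`. -/
noncomputable def lip0 (o : M) (a : ℕ → ℝ) (ha : ∃ C, ∀ n, |a n| ≤ C) : Lip0 o :=
  ⟨fun x => P.primitive a (dist o x), by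
    obtain ⟨C, hC⟩ := ha
    refine ⟨C.toNNReal, LipschitzWith.of_dist_le_mul fun x y => ?_⟩
    rw [Real.coe_toNNReal C ((abs_nonneg _).trans (hC 0)), dist_comm, Real.dist_eq]
    exact (P.abs_primitive_sub_le hC _ _).trans (mul_le_mul_of_nonneg_left
      ((dist_dist_dist_le_right o y x).trans_eq (dist_comm y x)) ((abs_nonneg _).trans (hC 0))), by
    simp [primitive]⟩

theorem lip0_apply (a : ℕ → ℝ) (ha : ∃ C, ∀ n, |a n| ≤ C) (x : M) :
    P.lip0 o a ha x = P.primitive a (dist o x) := rfl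

theorem norm_lip0_le (a : ℕ → ℝ) {C : ℝ} (hC : ∀ n, |a n| ≤ C) :
    ‖P.lip0 o a ⟨C, hC⟩‖ ≤ C := by
  have hC0 := (abs_nonneg _).trans (hC 0)
  refine Lip0.norm_le_of hC0 fun p q hpq => ?_
  rw [Lip0.slope, abs_div, abs_of_pos (dist_pos.2 hpq), div_le_iff₀ (dist_pos.2 hpq),
    lip0_apply, lip0_apply]
  exact (P.abs_primitive_sub_le hC _ _).trans
    (mul_le_mul_of_nonneg_left ((dist_dist_dist_le_right o q p).trans_eq (dist_comm q p)) hC0)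

/-- Along almost geodesics from `o` to a point at distance `c`, the slopes of `P.lip0 o a` are
almost those of `P.primitive a`. -/
theorem abs_primitive_sub_le_norm_lip0 (hM : IsLengthMetricSpace M) {x : M} (hx : dist o x = c)
    (a : ℕ → ℝ) (ha : ∃ C, ∀ n, |a n| ≤ C) {s t : ℝ} (hs : 0 ≤ s) (hst : s ≤ t) (ht : t ≤ c) :
    |P.primitive a t - P.primitive a s| ≤ ‖P.lip0 o a ha‖ * (t - s) := by
  have key : ∀ δ > 0,
      |P.primitive a t - P.primitive a s| ≤ ‖P.lip0 o a ha‖ * (t - s + δ) := by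
    intro δ hδ
    obtain ⟨u, v, hu, hv, huv⟩ := hM.exists_almost_between (x := o) (y := x)
      (ρ := dist o) (continuous_const.dist continuous_id) (by simpa using hs) hst (by rwa [hx]) hδ
    have h := Lip0.abs_sub_le (P.lip0 o a ha) u v
    rw [lip0_apply, lip0_apply, hu, hv] at h
    refine h.trans (mul_le_mul_of_nonneg_left ?_ (norm_nonneg _))
    linarith [dist_triangle o v x]
  have hlim : Filter.Tendsto (fun δ : ℝ => ‖P.lip0 o a ha‖ * (t - s + δ)) (nhdsWithin 0 (Set.Ioi 0))
      (nhds (‖P.lip0 o a ha‖ * (t - s + 0))) :=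
    (Continuous.tendsto (by fun_prop) 0).mono_left nhdsWithin_le_nhds
  rw [add_zero] at hlim
  exact ge_of_tendsto hlim (by filter_upwards [self_mem_nhdsWithin] with δ hδ using key δ hδ)

theorem abs_le_norm_lip0 (hM : IsLengthMetricSpace M) {x : M} (hx : dist o x = c)
    (a : ℕ → ℝ) (ha : ∃ C, ∀ n, |a n| ≤ C) (n : ℕ) : |a n| ≤ ‖P.lip0 o a ha‖ := by
  obtain ⟨C, hC⟩ := ha
  -- Some point of the `n`-th piece is not `c`, and `P.primitive a` has derivative `a n` there.
  obtain ⟨t, htP, htd, htc⟩ : ∃ t ∈ P.carrier ∩ P.index ⁻¹' {n},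
      HasDerivAt (P.primitive a) (P.density a t) t ∧ t ≠ c := by
    by_contra! hcon
    refine (P.volume_pos n).ne' (measure_mono_null (fun t ht => ?_) (measure_union_null
      (P.ae_hasDerivAt_primitive hC) ((Set.finite_singleton c).measure_zero volume)))
    by_cases hd : HasDerivAt (P.primitive a) (P.density a t) t
    · exact Or.inr (hcon t ht hd)
    · exact Or.inl hd
  rw [density_of_mem htP] at htd
  have htc' : t < c := lt_of_le_of_ne (P.subset_Icc htP.1).2 htc
  have ht0' : 0 ≤ t := (P.subset_Icc htP.1).1
  refine le_of_tendsto (htd.tendsto_slope.abs.mono_left (nhdsGT_le_nhdsNE t)) ?_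
  filter_upwards [Ioo_mem_nhdsGT htc'] with y hy
  rw [slope_def_field, abs_div, abs_of_pos (sub_pos.2 hy.1), div_le_iff₀ (sub_pos.2 hy.1)]
  exact P.abs_primitive_sub_le_norm_lip0 hM hx a ⟨C, hC⟩ ht0' hy.1.le hy.2.le

theorem lip0_notMem_closure_SNA (hM : IsLengthMetricSpace M) (a : ℕ → ℝ)
    (ha : ∃ C, ∀ n, |a n| ≤ C) (h₀ : P.lip0 o a ha ≠ 0) : P.lip0 o a ha ∉ closure (SNA o) := by
  obtain ⟨C, hC⟩ := ha
  exact notMem_closure_SNA hM (LipschitzWith.dist_right o)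
    (fun _ _ hxy => P.exists_primitive_eq a hC hxy) (fun _ => rfl) h₀

end CantorPartition

/-! ### Derivatives along a curve as elements of the Lipschitz-free space -/

section CurveFunctional

variable {M : Type*} [MetricSpace M] {o : M} {σ : ℝ → M}

theorem Lip0.lipschitzWith_comp (hσ : LipschitzWith 1 σ) (f : Lip0 o) :
    LipschitzWith ‖f‖₊ (fun t => f (σ t)) := by
  have hf : LipschitzWith ‖f‖₊ (f : M → ℝ) := LipschitzWith.of_dist_le_mul fun x y => by
    rw [dist_comm, Real.dist_eq, dist_comm x]
    exact (Lip0.abs_sub_le f y x).trans_eq' (abs_sub_comm _ _)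
  have h := hf.comp hσ
  rwa [mul_one] at h

theorem Lip0.abs_deriv_comp_le (hσ : LipschitzWith 1 σ) (f : Lip0 o) (t : ℝ) :
    ‖deriv (fun t => f (σ t)) t‖ ≤ ‖f‖ :=
  norm_deriv_le_of_lipschitz (f.lipschitzWith_comp hσ)

theorem Lip0.integrable_deriv_comp (hσ : LipschitzWith 1 σ) (f : Lip0 o) (μ : Measure ℝ)
    [IsFiniteMeasure μ] : Integrable (deriv fun t => f (σ t)) μ :=
  Integrable.of_bound (measurable_deriv _).aestronglyMeasurable ‖f‖
    (ae_of_all _ (f.abs_deriv_comp_le hσ))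

theorem Lip0.integral_deriv_comp (hσ : LipschitzWith 1 σ) (f : Lip0 o) (a b : ℝ) :
    ∫ t in a..b, deriv (fun t => f (σ t)) t = f (σ b) - f (σ a) :=
  (f.lipschitzWith_comp hσ).lipschitzOnWith.absolutelyContinuousOnInterval.integral_deriv_eq_sub

/-- The functional `f ↦ ∫_A (f ∘ σ)'` over a subset `A` of `[0, c]`, for a `1`-Lipschitz curve `σ`.
The part of `A` outside
`(0, c]` is ignored. -/
noncomputable def curveFunctional (o : M) (hσ : LipschitzWith 1 σ) (c : ℝ) (A : Set ℝ) :
    Lip0 o →L[ℝ] ℝ :=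
  LinearMap.mkContinuous
    { toFun := fun f => ∫ t in A, deriv (fun t => f (σ t)) t ∂(volume.restrict (Set.Ioc 0 c))
      map_add' := fun f g => by
        rw [← integral_add (f.integrable_deriv_comp hσ _) (g.integrable_deriv_comp hσ _)]
        refine integral_congr_ae (ae_restrict_of_ae (ae_restrict_of_ae ?_))
        filter_upwards [(f.lipschitzWith_comp hσ).ae_differentiableAt_real,
          (g.lipschitzWith_comp hσ).ae_differentiableAt_real] with t hf hg
        exact deriv_fun_add hf hg
      map_smul' := fun r f => by
        rw [RingHom.id_apply, smul_eq_mul, ← integral_const_mul]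
        exact integral_congr_ae (ae_of_all _ fun t => deriv_const_mul_field r) }
    ((volume.restrict (Set.Ioc 0 c)).real A) fun f => by
      rw [mul_comm, ← measureReal_restrict_apply_univ]
      exact norm_integral_le_of_norm_le_const (ae_of_all _ (f.abs_deriv_comp_le hσ))

theorem curveFunctional_apply (hσ : LipschitzWith 1 σ) (c : ℝ) (A : Set ℝ) (f : Lip0 o) :
    curveFunctional o hσ c A f
      = ∫ t in A, deriv (fun t => f (σ t)) t ∂(volume.restrict (Set.Ioc 0 c)) := rfl

theorem norm_curveFunctional_le (hσ : LipschitzWith 1 σ) (c : ℝ) (A : Set ℝ) :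
    ‖curveFunctional o hσ c A‖ ≤ (volume.restrict (Set.Ioc 0 c)).real A :=
  LinearMap.mkContinuous_norm_le _ measureReal_nonneg _

theorem curveFunctional_union (hσ : LipschitzWith 1 σ) (c : ℝ) {A B : Set ℝ} (hAB : Disjoint A B)
    (hB : MeasurableSet B) :
    curveFunctional o hσ c (A ∪ B) = curveFunctional o hσ c A + curveFunctional o hσ c B :=
  ContinuousLinearMap.ext fun f => setIntegral_union hAB hB
    (f.integrable_deriv_comp hσ _).integrableOn (f.integrable_deriv_comp hσ _).integrableOn

theorem curveFunctional_Iic (hσ : LipschitzWith 1 σ) {c : ℝ} (t : ℝ) :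
    curveFunctional o hσ c (Set.Iic t)
      = evalDelta o (σ (max 0 (min t c))) - evalDelta o (σ 0) := by
  ext f
  have hset : Set.Iic t ∩ Set.Ioc 0 c = Set.Ioc 0 (max 0 (min t c)) := by
    ext s
    simp only [Set.mem_inter_iff, Set.mem_Iic, Set.mem_Ioc, le_max_iff, le_min_iff]
    constructor
    · rintro ⟨h₁, h₂, h₃⟩
      exact ⟨h₂, Or.inr ⟨h₁, h₃⟩⟩
    · rintro ⟨h₁, h₂ | h₂⟩
      · exact absurd h₁ h₂.not_gt
      · exact ⟨h₂.1, h₁, h₂.2⟩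
  rw [curveFunctional_apply, Measure.restrict_restrict measurableSet_Iic, hset,
    ← intervalIntegral.integral_of_le (le_max_left _ _), f.integral_deriv_comp hσ]
  rfl

theorem evalDelta_mem_freeSubmodule (o x : M) : evalDelta o x ∈ freeSubmodule o :=
  Submodule.le_topologicalClosure _ (Submodule.subset_span ⟨x, rfl⟩)

/-- The sets `A` for which the functional is in `F(M)` form a Dynkin system, and they include the
half-lines by the fundamental theorem of calculus. -/
theorem curveFunctional_mem_freeSubmodule (hσ : LipschitzWith 1 σ) (c : ℝ) {A : Set ℝ}
    (hA : MeasurableSet A) : curveFunctional o hσ c A ∈ freeSubmodule o := by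
  have hIic : ∀ t, curveFunctional o hσ c (Set.Iic t) ∈ freeSubmodule o := fun t => by
    rw [curveFunctional_Iic]
    exact sub_mem (evalDelta_mem_freeSubmodule _ _) (evalDelta_mem_freeSubmodule _ _)
  have hempty : curveFunctional o hσ c ∅ = 0 := by
    ext f
    rw [curveFunctional_apply, Measure.restrict_empty, integral_zero_measure]
    rfl
  have huniv : curveFunctional o hσ c Set.univ = curveFunctional o hσ c (Set.Iic c) := by
    ext f
    rw [curveFunctional_apply, curveFunctional_apply, Measure.restrict_univ,
      Measure.restrict_restrict measurableSet_Iic,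
      Set.inter_eq_right.2 (Set.Ioc_subset_Iic_self : Set.Ioc 0 c ⊆ Set.Iic c)]
  induction A, hA using MeasurableSpace.induction_on_inter
    (borel_eq_generateFrom_Iic ℝ ▸ (BorelSpace.measurable_eq (α := ℝ))) isPiSystem_Iic with
  | empty => simp [hempty]
  | basic A hA =>
    obtain ⟨t, rfl⟩ := hA
    exact hIic t
  | compl A hA ih =>
    have h := curveFunctional_union (o := o) hσ c (disjoint_compl_right (a := A)) hA.compl
    rw [Set.union_compl_self, huniv] at h
    rw [← add_sub_cancel_left (curveFunctional o hσ c A) (curveFunctional o hσ c Aᶜ), ← h]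
    exact sub_mem (hIic c) ih
  | iUnion A hdisj hA ih =>
    have hacc : ∀ n, MeasurableSet (Set.accumulate A n) := fun n =>
      MeasurableSet.biUnion (Set.to_countable _) fun i _ => hA i
    have hmem : ∀ n, curveFunctional o hσ c (Set.accumulate A n) ∈ freeSubmodule o := by
      intro n
      induction n with
      | zero => simpa [Set.accumulate_zero_nat] using ih 0
      | succ n ihn =>
        rw [Set.accumulate_succ, curveFunctional_union hσ c
          (Set.disjoint_accumulate hdisj n.lt_succ_self) (hA _)]
        exact add_mem ihn (ih _)
    have hdiff : ∀ n, ‖curveFunctional o hσ c (Set.accumulate A n)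
        - curveFunctional o hσ c (⋃ i, A i)‖
          ≤ (volume.restrict (Set.Ioc 0 c)).real (⋃ i, A i)
            - (volume.restrict (Set.Ioc 0 c)).real (Set.accumulate A n) := by
      intro n
      have hsub : Set.accumulate A n ⊆ ⋃ i, A i := Set.accumulate_subset_iUnion n
      have h := curveFunctional_union (o := o) hσ c
        (Set.disjoint_sdiff_right (s := Set.accumulate A n) (t := ⋃ i, A i))
        ((MeasurableSet.iUnion hA).diff (hacc n))
      rw [Set.union_sdiff_cancel hsub] at h
      rw [h, sub_add_cancel_left, norm_neg, ← measureReal_sdiff hsub (hacc n)]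
      exact norm_curveFunctional_le hσ c _
    have hlim : Filter.Tendsto (fun n => (volume.restrict (Set.Ioc 0 c)).real (⋃ i, A i)
        - (volume.restrict (Set.Ioc 0 c)).real (Set.accumulate A n)) Filter.atTop (nhds 0) := by
      have h : Filter.Tendsto (fun n => (volume.restrict (Set.Ioc 0 c)).real (Set.accumulate A n))
          Filter.atTop (nhds ((volume.restrict (Set.Ioc 0 c)).real (⋃ i, A i))) :=
        (ENNReal.tendsto_toReal (measure_ne_top _ _)).comp tendsto_measure_iUnion_accumulate
      simpa using h.const_sub ((volume.restrict (Set.Ioc 0 c)).real (⋃ i, A i))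
    exact (Submodule.isClosed_topologicalClosure _).mem_of_tendsto
      (tendsto_iff_norm_sub_tendsto_zero.2 (squeeze_zero (fun _ => norm_nonneg _) hdiff hlim))
      (Filter.Eventually.of_forall hmem)

end CurveFunctional

/-- It suffices to attain the norm of `f` at an element of the unit ball of `F(M)`. -/
theorem mem_NAFree {M : Type*} [MetricSpace M] {o : M} {f : Lip0 o} (hf : f ≠ 0)
    {μ : Lip0 o →L[ℝ] ℝ} (hμ : μ ∈ freeSubmodule o) (hμ₁ : ‖μ‖ ≤ 1) (hμf : |μ f| = ‖f‖) :
    f ∈ NAFree o := by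
  have hpos : 0 < ‖f‖ := norm_pos_iff.2 hf
  have hμ' : ‖μ‖ = 1 := by
    refine le_antisymm hμ₁ (le_of_mul_le_mul_right ?_ hpos)
    rw [one_mul]
    exact hμf.symm.trans_le (μ.le_opNorm f)
  have hle : ‖LipschitzFree.functional f‖ ≤ ‖f‖ :=
    ContinuousLinearMap.opNorm_le_bound _ hpos.le fun ν => by
      rw [LipschitzFree.functional_apply, mul_comm, ← (LipschitzFree.incl o).norm_map ν]
      exact (LipschitzFree.incl o ν).le_opNorm f
  let ν : LipschitzFree o := ⟨μ, hμ⟩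
  have hν : ‖ν‖ = 1 := hμ'
  have hνf : |LipschitzFree.functional f ν| = ‖f‖ := hμf
  refine ⟨ν, hν, le_antisymm ?_ (hle.trans_eq hνf.symm)⟩
  simpa [hν] using (LipschitzFree.functional f).le_opNorm ν

/-- In a metrically convex space `P.lip0 o a` attains its norm at the normalized functional
`f ↦ |K_n|⁻¹ ∫_{K_n} (f ∘ σ)'`, where `K_n` is a piece with `|a n|` maximal, and `σ` is a geodesic
from `o` to a point at distance `c`. -/
theorem CantorPartition.lip0_mem_NAFree {c : ℝ} (P : CantorPartition c) {M : Type*} [MetricSpace M]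
    {o : M} (hM : IsMetricallyConvex M) {x : M} (hx : dist o x = c) (a : ℕ → ℝ) {n : ℕ}
    (ha : ∀ m, |a m| ≤ |a n|) (h₀ : P.lip0 o a ⟨_, ha⟩ ≠ 0) : P.lip0 o a ⟨_, ha⟩ ∈ NAFree o := by
  obtain ⟨σ, hσ, hσo⟩ := hM.exists_geodesic o x
  rw [hx] at hσo
  have hnorm : ‖P.lip0 o a ⟨_, ha⟩‖ = |a n| := le_antisymm (P.norm_lip0_le a ha)
    (P.abs_le_norm_lip0 hM.isLengthMetricSpace hx a ⟨_, ha⟩ n)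
  set A := P.carrier ∩ P.index ⁻¹' {n}
  set ν := volume.restrict (Set.Ioc 0 c) with hν
  have hAm : MeasurableSet A := P.measurableSet_piece n
  have hAc : A ⊆ Set.Icc 0 c := Set.inter_subset_left.trans P.subset_Icc
  have hνA : 0 < ν.real A := by
    rw [hν, Measure.restrict_congr_set Ioc_ae_eq_Icc, measureReal_restrict_apply hAm,
      Set.inter_eq_left.2 hAc]
    exact ENNReal.toReal_pos (P.volume_pos n).ne'
      ((measure_mono hAc).trans_lt measure_Icc_lt_top).ne
  have hval : curveFunctional o hσ c A (P.lip0 o a ⟨_, ha⟩) = ν.real A * a n := by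
    rw [curveFunctional_apply, ← smul_eq_mul, ← setIntegral_const, ← hν]
    refine setIntegral_congr_ae hAm ?_
    have hd : ∀ᵐ t ∂ν, HasDerivAt (P.primitive a) (P.density a t) t :=
      ae_restrict_of_ae (P.ae_hasDerivAt_primitive ha)
    have hmem : ∀ᵐ t ∂ν, t ∈ Set.Ioo 0 c := by
      rw [hν, ← Measure.restrict_congr_set Ioo_ae_eq_Ioc]
      exact ae_restrict_mem measurableSet_Ioo
    filter_upwards [hd, hmem] with t ht htc htA
    rw [density_of_mem htA] at ht
    refine (ht.congr_of_eventuallyEq ?_).deriv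
    filter_upwards [Ioo_mem_nhds htc.1 htc.2] with s hs
    rw [lip0_apply, hσo s (Set.Ioo_subset_Icc_self hs)]
  refine mem_NAFree h₀ (μ := (ν.real A)⁻¹ • curveFunctional o hσ c A)
    (Submodule.smul_mem _ _ (curveFunctional_mem_freeSubmodule hσ c hAm)) ?_ ?_
  · rw [norm_smul, norm_inv, Real.norm_of_nonneg hνA.le, inv_mul_le_iff₀ hνA, mul_one]
    exact norm_curveFunctional_le hσ c A
  · rw [smul_apply, hval, smul_eq_mul, inv_mul_cancel_left₀ hνA.ne', hnorm]

/-! ### The isometric copies -/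

/-- The isometry `z ↦ P.lip0 o z`, for a space `X` of bounded sequences with the supremum norm,
given with its inclusion `J` in the space of all sequences. -/
noncomputable def CantorPartition.lip0Isometry {c : ℝ} (P : CantorPartition c) {M : Type*}
    [MetricSpace M] {o : M} (hM : IsLengthMetricSpace M) {x : M} (hx : dist o x = c) {X : Type*}
    [NormedAddCommGroup X] [NormedSpace ℝ X] (J : X →ₗ[ℝ] (ℕ → ℝ)) (hJ : ∀ z n, |J z n| ≤ ‖z‖)
    (hJ' : ∀ z C, 0 ≤ C → (∀ n, |J z n| ≤ C) → ‖z‖ ≤ C) : X →ₗᵢ[ℝ] Lip0 o where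
  toFun z := P.lip0 o (J z) ⟨_, hJ z⟩
  map_add' z w := Lip0.ext fun y => by
    rw [Lip0.add_apply, lip0_apply, lip0_apply, lip0_apply, map_add,
      P.primitive_add (hJ z) (hJ w)]
  map_smul' r z := Lip0.ext fun y => by
    rw [RingHom.id_apply, Lip0.smul_apply, lip0_apply, lip0_apply, map_smul, P.primitive_smul]
  norm_map' z := le_antisymm (P.norm_lip0_le (J z) (hJ z))
    (hJ' z _ (norm_nonneg _) fun n => P.abs_le_norm_lip0 hM hx (J z) ⟨_, hJ z⟩ n)

/-- The supremum norm of a sequence tending to zero is attained. -/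
theorem ZeroAtInftyContinuousMap.exists_forall_abs_le (z : C₀(ℕ, ℝ)) :
    ∃ n, ∀ m, |z m| ≤ |z n| := by
  by_cases hz : ∀ m, z m = 0
  · exact ⟨0, fun m => by simp [hz]⟩
  · obtain ⟨k, hk⟩ := not_forall.1 hz
    have hlim : Filter.Tendsto (fun m => |z m|) (Filter.cocompact ℕ) (nhds 0) := by
      simpa using (zero_at_infty z).abs
    exact (z.continuous.abs).exists_forall_ge' k ((hlim.eventually_lt_const (abs_pos.2 hk)).mono
      fun _ h => h.le)

theorem mainTheorem4 {M : Type*} [MetricSpace M] [Nontrivial M] (o : M) :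
    (CompleteSpace M → IsLengthMetricSpace M →
      IsometricallyContains ((Set.univ \ closure (SNA o)) ∪ {0}) (lp (fun _ : ℕ => ℝ) ∞)) ∧
    (IsMetricallyConvex M →
      IsometricallyContains ((NAFree o \ closure (SNA o)) ∪ {0}) C₀(ℕ, ℝ)) := by
  obtain ⟨x, hx⟩ := exists_ne o
  obtain ⟨P⟩ := CantorPartition.nonempty (dist_pos.2 hx.symm)
  refine ⟨fun _ hM => ?_, fun hM => ?_⟩
  · let T := P.lip0Isometry hM rfl
      { toFun := fun z : lp (fun _ : ℕ => ℝ) ∞ => (z : ℕ → ℝ)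
        map_add' := fun _ _ => rfl
        map_smul' := fun _ _ => rfl }
      (fun z n => lp.norm_apply_le_norm ENNReal.top_ne_zero z n)
      (fun z C hC h => lp.norm_le_of_forall_le hC h)
    refine ⟨T, ?_⟩
    rintro _ ⟨z, rfl⟩
    by_cases h₀ : T z = 0
    · exact Or.inr h₀
    · exact Or.inl ⟨Set.mem_univ _, P.lip0_notMem_closure_SNA hM _
        ⟨_, lp.norm_apply_le_norm ENNReal.top_ne_zero z⟩ h₀⟩
  · let T := P.lip0Isometry hM.isLengthMetricSpace rfl
      { toFun := fun z : C₀(ℕ, ℝ) => (z : ℕ → ℝ)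
        map_add' := fun _ _ => rfl
        map_smul' := fun _ _ => rfl }
      (fun z n => z.toBCF.norm_coe_le_norm n)
      (fun z C hC h => (BoundedContinuousFunction.norm_le (f := z.toBCF) hC).2 h)
    refine ⟨T, ?_⟩
    rintro _ ⟨z, rfl⟩
    by_cases h₀ : T z = 0
    · exact Or.inr h₀
    · obtain ⟨n, hn⟩ := z.exists_forall_abs_le
      exact Or.inl ⟨P.lip0_mem_NAFree hM rfl _ hn h₀,
        P.lip0_notMem_closure_SNA hM.isLengthMetricSpace _ ⟨_, hn⟩ h₀⟩
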